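/- A complex variety is an integral, separated scheme of finite type over $\mathbb{C}$. Let $g\colon Z\to W$ be a morphism over $\mathbb{C}$ between smooth complex varieties which is proper and generically étale, i.e. étale on some dense open subset of $Z$ (so that $g$ is dominant and induces an embedding of function fields $g^*\colon\mathbb{C}(W)\hookrightarrow\mathbb{C}(Z)$). Let $k\ge 0$. A meromorphic $k$-form on a variety $X$ is an element of $\bigwedge^k_{\mathbb{C}(X)}\Omega_{\mathbb{C}(X)/\mathbb{C}}$, the stalk of $\Omega^k_{X/\mathbb{C}}$ at the generic point; it is called regular if it is the germ at the generic point of some global section of $\Omega^k_{X/\mathbb{C}}$. The pull-back $g^*\omega$ of a meromorphic $k$-form $\omega$ on $W$ is its image under the map $\bigwedge^k\Omega_{\mathbb{C}(W)/\mathbb{C}}\to\bigwedge^k\Omega_{\mathbb{C}(Z)/\mathbb{C}}$ induced by $g^*$. Then a meromorphic $k$-form $\omega$ on $W$ is regular if and only if $g^*\omega$ is regular on $Z$. -/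

import Mathlib

open CategoryTheory AlgebraicGeometry

noncomputable section

namespace MeroForms

/-! ### Functoriality of `k`-forms on algebras -/

section Algebra

variable {R A B : Type*} [CommRing R] [CommRing A] [CommRing B] [Algebra R A] [Algebra R B]

/-- For a homomorphism `φ : A → B` of `R`-algebras, the induced `φ`-semilinear map
`⋀^k Ω_{A/R} → ⋀^k Ω_{B/R}`,
`a₀ da₁ ∧ ⋯ ∧ daₖ ↦ φ(a₀) dφ(a₁) ∧ ⋯ ∧ dφ(aₖ)`. -/
def formMap (φ : A →ₐ[R] B) (k : ℕ) :
    ⋀[A]^k (Ω[A⁄R]) →ₛₗ[(φ : A →+* B)] ⋀[B]^k (Ω[B⁄R]) :=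
  letI : Algebra A B := (φ : A →+* B).toAlgebra
  haveI : IsScalarTower R A B := IsScalarTower.of_algebraMap_eq fun r => (φ.commutes r).symm
  let f : ⋀[A]^k (Ω[A⁄R]) →ₗ[A] ⋀[B]^k (Ω[B⁄R]) :=
    exteriorPower.alternatingMapLinearEquiv
      (({ ((exteriorPower.ιMulti B k (M := Ω[B⁄R])).toMultilinearMap.restrictScalars A) with
          map_eq_zero_of_eq' := fun v i j h hij =>
            (exteriorPower.ιMulti B k (M := Ω[B⁄R])).map_eq_zero_of_eq v h hij } :
          Ω[B⁄R] [⋀^Fin k]→ₗ[A] ⋀[B]^k (Ω[B⁄R])).compLinearMap (KaehlerDifferential.map R R A B))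
  { toFun := f
    map_add' := f.map_add
    map_smul' := fun a x => by
      rw [f.map_smul]
      exact algebra_compatible_smul B a (f x) }

lemma formMap_ιMulti_D (φ : A →ₐ[R] B) (k : ℕ) (a : Fin k → A) :
    formMap φ k (exteriorPower.ιMulti A k fun i => KaehlerDifferential.D R A (a i)) =
      exteriorPower.ιMulti B k fun i => KaehlerDifferential.D R B (φ (a i)) := by
  let _ : Algebra A B := (φ : A →+* B).toAlgebra
  have : IsScalarTower R A B := IsScalarTower.of_algebraMap_eq fun r => (φ.commutes r).symm
  refine (exteriorPower.alternatingMapLinearEquiv_apply_ιMulti _ _).trans ?_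
  change exteriorPower.ιMulti B k _ = _
  congr 1
  funext i
  exact KaehlerDifferential.map_D R R A B (a i)

end Algebra

/-! ### Complex varieties -/

/-- `Spec ℂ`. -/
abbrev SpecC : Scheme.{0} := Spec (CommRingCat.of ℂ)

/-- A complex variety: an integral, separated scheme of finite type over `Spec ℂ`. -/
class IsComplexVariety (X : Scheme.{0}) [X.Over SpecC] : Prop where
  isIntegral : IsIntegral X
  isSeparated : IsSeparated (X ↘ SpecC)
  locallyOfFiniteType : LocallyOfFiniteType (X ↘ SpecC)
  quasiCompact : QuasiCompact (X ↘ SpecC)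

attribute [instance] IsComplexVariety.isIntegral IsComplexVariety.isSeparated
  IsComplexVariety.locallyOfFiniteType IsComplexVariety.quasiCompact

/-- The ring homomorphism `ℂ → Γ(X, ⊤)` given by the structure morphism `X → Spec ℂ`. -/
def scalars (X : Scheme.{0}) [X.Over SpecC] : CommRingCat.of ℂ ⟶ Γ(X, ⊤) :=
  (Scheme.ΓSpecIso (CommRingCat.of ℂ)).inv ≫ (X ↘ SpecC).appTop

instance algebraSections (X : Scheme.{0}) [X.Over SpecC] (U : X.Opens) : Algebra ℂ Γ(X, U) :=
  (scalars X ≫ X.presheaf.map (homOfLE le_top).op).hom.toAlgebra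

instance algebraStalk (X : Scheme.{0}) [X.Over SpecC] (x : X) :
    Algebra ℂ (X.presheaf.stalk x) :=
  (scalars X ≫ X.presheaf.germ ⊤ x (TopologicalSpace.Opens.mem_top x)).hom.toAlgebra

/-- Restriction of functions, as a homomorphism of `ℂ`-algebras. -/
def res (X : Scheme.{0}) [X.Over SpecC] {U V : X.Opens} (h : U ≤ V) : Γ(X, V) →ₐ[ℂ] Γ(X, U) :=
  { (X.presheaf.map (homOfLE h).op).hom with
    commutes' := fun r => by
      change (X.presheaf.map (homOfLE h).op).hom
        ((scalars X ≫ X.presheaf.map (homOfLE le_top).op).hom r) =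
          (scalars X ≫ X.presheaf.map (homOfLE le_top).op).hom r
      rw [← CommRingCat.comp_apply, Category.assoc, ← Functor.map_comp]
      rfl }

/-- Passage to the germ at a point, as a homomorphism of `ℂ`-algebras. -/
def germ (X : Scheme.{0}) [X.Over SpecC] (U : X.Opens) (x : X) (hx : x ∈ U) :
    Γ(X, U) →ₐ[ℂ] X.presheaf.stalk x :=
  { (X.presheaf.germ U x hx).hom with
    commutes' := fun r => by
      change (X.presheaf.germ U x hx).hom
        ((scalars X ≫ X.presheaf.map (homOfLE le_top).op).hom r) =
          (scalars X ≫ X.presheaf.germ ⊤ x (TopologicalSpace.Opens.mem_top x)).hom r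
      rw [← CommRingCat.comp_apply, Category.assoc, TopCat.Presheaf.germ_res] }

/-- The generic point of an irreducible scheme lies in every nonempty open subset. -/
lemma genericPoint_mem (X : Scheme.{0}) [IrreducibleSpace X] (U : X.Opens)
    (hU : (U : Set X).Nonempty) : genericPoint X ∈ U :=
  ((genericPoint_spec X).mem_open_set_iff U.isOpen).mpr (by simpa using hU)

/-! ### Regular and meromorphic forms -/

/-- A regular `k`-form on `X`, i.e. a global section of the quasi-coherent sheaf `Ω^k_{X/ℂ}`:
a compatible family of elements of `⋀^k Ω_{Γ(X, U)/ℂ}` for all affine open subsets `U`. -/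
structure RegularForm (X : Scheme.{0}) [X.Over SpecC] (k : ℕ) where
  val : ∀ U : X.affineOpens, ⋀[Γ(X, U)]^k (Ω[Γ(X, U)⁄ℂ])
  compat : ∀ (U V : X.affineOpens) (h : (U : X.Opens) ≤ V), formMap (res X h) k (val V) = val U

/-- A meromorphic (i.e. rational) `k`-form on the integral scheme `X`: an element of the stalk
`⋀^k Ω_{ℂ(X)/ℂ}` of `Ω^k_{X/ℂ}` at the generic point. -/
abbrev MeromorphicForm (X : Scheme.{0}) [X.Over SpecC] [IsIntegral X] (k : ℕ) : Type :=
  ⋀[X.functionField]^k (Ω[X.functionField⁄ℂ])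

/-- A meromorphic form `ω` is regular if there is a regular form on all of `X` whose
germ at the generic point is `ω`. -/
def IsRegular {X : Scheme.{0}} [X.Over SpecC] [IsIntegral X] {k : ℕ}
    (ω : MeromorphicForm X k) : Prop :=
  ∃ η : RegularForm X k, ∀ (U : X.affineOpens) (hU : ((U : X.Opens) : Set X).Nonempty),
    formMap (germ X U (genericPoint X) (genericPoint_mem X U hU)) k (η.val U) = ω

/-! ### Generically étale morphisms and pull-back -/

/-- A morphism is generically étale if it is étale on a dense open subset of its source. -/
def GenericallyEtale {Z W : Scheme.{0}} (g : Z ⟶ W) : Prop :=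
  ∃ V : Z.Opens, Dense (V : Set Z) ∧ Etale (V.ι ≫ g)

lemma GenericallyEtale.isDominant {Z W : Scheme.{0}} [IsIntegral Z] [IsIntegral W] {g : Z ⟶ W}
    (hg : GenericallyEtale g) : IsDominant g := by
  obtain ⟨V, hV, hVg⟩ := hg
  obtain ⟨z, hz⟩ := hV.nonempty
  have hopen : IsOpen (Set.range (V.ι ≫ g)) := (V.ι ≫ g).isOpenMap.isOpen_range
  have hd : DenseRange (V.ι ≫ g) := hopen.dense ⟨_, ⟨⟨z, hz⟩, rfl⟩⟩
  have : IsDominant (V.ι ≫ g) := ⟨hd⟩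
  exact IsDominant.of_comp V.ι g

lemma map_genericPoint {Z W : Scheme.{0}} [IsIntegral Z] [IsIntegral W] (g : Z ⟶ W)
    [IsDominant g] : g (genericPoint Z) = genericPoint W := by
  apply ((genericPoint_spec W).eq _).symm
  have h := (genericPoint_spec Z).image g.continuous
  rwa [Set.image_univ, g.denseRange.closure_range] at h

/-- The embedding of function fields `ℂ(W) → ℂ(Z)` given by a dominant morphism `g : Z → W`
over `ℂ`. -/
def functionFieldMap {Z W : Scheme.{0}} [Z.Over SpecC] [W.Over SpecC] [IsIntegral Z]
    [IsIntegral W] (g : Z ⟶ W) [g.IsOver SpecC] [IsDominant g] :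
    W.functionField →ₐ[ℂ] Z.functionField :=
  { (W.presheaf.stalkSpecializes (specializes_of_eq (map_genericPoint g)) ≫
      g.stalkMap (genericPoint Z)).hom with
    commutes' := fun r => by
      change (W.presheaf.stalkSpecializes (specializes_of_eq (map_genericPoint g)) ≫
        g.stalkMap (genericPoint Z)).hom
          ((scalars W ≫ W.presheaf.germ ⊤ _ (TopologicalSpace.Opens.mem_top _)).hom r) =
            (scalars Z ≫ Z.presheaf.germ ⊤ _ (TopologicalSpace.Opens.mem_top _)).hom r
      rw [← CommRingCat.comp_apply]
      congr 2
      have h : scalars W ≫ g.appTop = scalars Z := by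
        simp only [scalars, Category.assoc]
        rw [← Scheme.Hom.comp_appTop, comp_over]
      rw [← h]
      simp only [Category.assoc, TopCat.Presheaf.germ_stalkSpecializes_assoc]
      erw [Scheme.Hom.germ_stalkMap]
      rfl }

/-- The pull-back `g^*ω` of a meromorphic `k`-form along a dominant morphism. -/
def pullbackForm {Z W : Scheme.{0}} [Z.Over SpecC] [W.Over SpecC] [IsIntegral Z]
    [IsIntegral W] (g : Z ⟶ W) [g.IsOver SpecC] (hg : IsDominant g) {k : ℕ}
    (ω : MeromorphicForm W k) : MeromorphicForm Z k :=
  formMap (functionFieldMap g) k ω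

end MeroForms

end

/-!
A regular form pulls back to a regular form by functoriality, so the point is the converse. Let
`ω` be a meromorphic form on `W` such that `g^*ω` is regular.

On a smooth integral scheme, `Ω` is locally a direct summand of a free module. Hence a meromorphic
form has, over an affine open subset with coordinate ring `A`, finitely many coordinates in the
fraction field `K` of `A` (`formCoord`), and it is regular there precisely if these lie in `A`
(`mem_range_formMap_of_formCoord`). This makes regularity a local property
(`isRegular_iff_forall_exists`). As `A` is smooth, it is normal (`isIntegrallyClosed_of_smooth`), so
it is the intersection of those of its localizations `R` which are discrete valuation rings
(`exists_isDiscreteValuationRing_of_notMem_range`), and it suffices to show that the coordinates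
of `ω` lie in each such `R`.

Because `g` is generically étale, `L = ℂ(Z)` is a finite extension of `K = ℂ(W)`
(`GenericallyEtale.finite_functionFieldMap`). Let `V` be the localization of the integral closure
of `R` in `L` at a maximal ideal. By the valuative criterion of properness, `Spec V → W` lifts
to `Z` (`exists_affine_sections_to_valuationRing`), so `g^*ω` comes from a form on `V`. Choose
uniformizers `t` of `R` and `s` of `V`, and write `t = s ^ (e + 1) u`. In characteristic zero the
extension is tame: `Ω_V` is generated by `Ω_R` and the single element `τ = (e + 1) u ds + s du`,
and `s ^ e τ = dt` (`exists_span_insert_eq_top`). As `τ` occurs at most once in a nonzero wedge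
product, `s ^ e` maps forms on `V` to combinations of forms on `R` (`exists_smul_mem_span_formMap`).
So for each coordinate `a ∈ K` of `ω` the product `s ^ e a` lies in `V`. The pole of `a` along `s`
has therefore order at most `e`, but it is a multiple of the ramification index `e + 1`; thus
`a ∈ R` (`mem_range_of_pow_mul_mem_range`).
-/

noncomputable section

namespace MeroForms

open KaehlerDifferential

/-! ### Differential forms on algebras -/

section Forms

variable {F A B C : Type*} [CommRing F] [CommRing A] [CommRing B] [CommRing C]
  [Algebra F A] [Algebra F B] [Algebra F C]

lemma span_ιMulti_D (F A : Type*) [CommRing F] [CommRing A] [Algebra F A] (n : ℕ) :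
    Submodule.span A (Set.range fun a : Fin n → A =>
      exteriorPower.ιMulti A n fun i => D F A (a i)) = ⊤ := by
  rw [← exteriorPower.ιMulti_span_of_span A n _ (span_range_derivation F A)]
  congr 1
  ext x
  constructor
  · rintro ⟨a, rfl⟩
    exact ⟨_, by rintro _ ⟨i, rfl⟩; exact ⟨a i, rfl⟩, rfl⟩
  · rintro ⟨v, hv, rfl⟩
    choose a ha using fun i => hv ⟨i, rfl⟩
    exact ⟨a, by simp only [ha]⟩

/-- Induction principle for forms: a property that is stable under addition and scalar
multiplication and holds for all `da₁ ∧ ⋯ ∧ daₙ` holds for all `n`-forms. -/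
lemma form_induction {n : ℕ} {p : ⋀[A]^n (Ω[A⁄F]) → Prop}
    (hD : ∀ a : Fin n → A, p (exteriorPower.ιMulti A n fun i => D F A (a i)))
    (hadd : ∀ x y, p x → p y → p (x + y)) (hsmul : ∀ (a : A) x, p x → p (a • x))
    (x : ⋀[A]^n (Ω[A⁄F])) : p x := by
  have hx : x ∈ Submodule.span A (Set.range fun a : Fin n → A =>
      exteriorPower.ιMulti A n fun i => D F A (a i)) := by
    rw [span_ιMulti_D]; trivial
  induction hx using Submodule.span_induction with
  | mem x h => obtain ⟨a, rfl⟩ := h; exact hD a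
  | zero => simpa using hsmul 0 _ (hD fun _ => 0)
  | add x y _ _ hx hy => exact hadd x y hx hy
  | smul a x _ hx => exact hsmul a x hx

lemma formMap_comp (ψ : B →ₐ[F] C) (φ : A →ₐ[F] B) {n : ℕ} (x : ⋀[A]^n (Ω[A⁄F])) :
    formMap (ψ.comp φ) n x = formMap ψ n (formMap φ n x) := by
  induction x using form_induction with
  | hD a => simp only [formMap_ιMulti_D, AlgHom.comp_apply]
  | hadd x y hx hy => simp only [map_add, hx, hy]
  | hsmul a x hx => simp only [map_smulₛₗ, hx]; rfl

/-! ### Coordinates of forms -/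

variable [Algebra A B] [IsScalarTower F A B] [Algebra A C] [IsScalarTower F A C]
  [Algebra B C] [IsScalarTower F B C] [IsScalarTower A B C]

variable (B) in
/-- The `B`-linear extension `Ω_{B/F} = B ⊗ Ω_{A/F} → Bᵈ` of an `A`-linear map
`Ω_{A/F} → Aᵈ`, for a formally étale `A`-algebra `B`. -/
def extendCoord [Algebra.FormallyEtale A B] {d : ℕ} (i : Ω[A⁄F] →ₗ[A] (Fin d → A)) :
    Ω[B⁄F] →ₗ[B] (Fin d → B) :=
  (isBaseChange_of_formallyEtale F A B).lift
    ((LinearMap.compLeft (Algebra.linearMap A B) (Fin d)).comp i)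

lemma extendCoord_D [Algebra.FormallyEtale A B] {d : ℕ} (i : Ω[A⁄F] →ₗ[A] (Fin d → A))
    (a : A) (j : Fin d) :
    extendCoord B i (D F B (algebraMap A B a)) j = algebraMap A B (i (D F A a) j) := by
  rw [← map_D F F A B a, extendCoord, IsBaseChange.lift_eq]
  rfl

lemma span_D_algebraMap [Algebra.FormallyEtale A B] :
    Submodule.span B (Set.range fun a : A => D F B (algebraMap A B a)) = ⊤ := by
  rw [eq_top_iff]
  rintro x -
  induction x using (isBaseChange_of_formallyEtale F A B).inductionOn with
  | zero => exact zero_mem _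
  | tmul m =>
    have hm : m ∈ Submodule.span A (Set.range (D F A)) := by
      rw [span_range_derivation]; trivial
    induction hm using Submodule.span_induction with
    | mem x h =>
      obtain ⟨a, rfl⟩ := h
      rw [map_D]
      exact Submodule.subset_span ⟨a, rfl⟩
    | zero => rw [map_zero]; exact zero_mem _
    | add x y _ _ hx hy => rw [map_add]; exact add_mem hx hy
    | smul a x _ hx =>
      rw [LinearMap.map_smul, algebra_compatible_smul B]
      exact Submodule.smul_mem _ _ hx
  | smul b m hm => exact Submodule.smul_mem _ _ hm
  | add x y hx hy => exact add_mem hx hy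

lemma extendCoord_extendCoord [Algebra.FormallyEtale A B] [Algebra.FormallyEtale A C]
    {d : ℕ} (i : Ω[A⁄F] →ₗ[A] (Fin d → A)) (b : B) (j : Fin d) :
    extendCoord C i (D F C (algebraMap B C b)) j =
      algebraMap B C (extendCoord B i (D F B b) j) := by
  have key : ∀ x : Ω[B⁄F], extendCoord C i (map F F B C x) j =
      algebraMap B C (extendCoord B i x j) := by
    intro x
    have hx : x ∈ Submodule.span B (Set.range fun a : A => D F B (algebraMap A B a)) := by
      rw [span_D_algebraMap]; trivial
    induction hx using Submodule.span_induction with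
    | mem x h =>
      obtain ⟨a, rfl⟩ := h
      simp only [map_D, extendCoord_D, ← IsScalarTower.algebraMap_apply]
    | zero => simp
    | add x y _ _ hx hy => simp only [map_add, Pi.add_apply, hx, hy]
    | smul b x _ hx =>
      rw [LinearMap.map_smul, algebra_compatible_smul C, LinearMap.map_smul, Pi.smul_apply, hx]
      simp
  rw [← map_D F F B C b, key]

variable (B) in
/-- The coordinates of an `n`-form on a formally étale `A`-algebra `B`, with respect to a linear
map `i : Ω_{A/F} → Aᵈ`: the coordinates of its image in `⋀ⁿ Bᵈ`. -/
def formCoord [Algebra.FormallyEtale A B] {d : ℕ} (i : Ω[A⁄F] →ₗ[A] (Fin d → A)) {n : ℕ}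
    (J : Set.powersetCard (Fin d) n) : ⋀[B]^n (Ω[B⁄F]) →ₗ[B] B :=
  (exteriorPower.ιMultiDual B n (Pi.basisFun B (Fin d)) J).comp
    (exteriorPower.map n (extendCoord B i))

lemma formCoord_formMap [Algebra.FormallyEtale A B] [Algebra.FormallyEtale A C]
    {d : ℕ} (i : Ω[A⁄F] →ₗ[A] (Fin d → A)) {n : ℕ}
    (J : Set.powersetCard (Fin d) n) (x : ⋀[B]^n (Ω[B⁄F])) :
    formCoord C i J (formMap (IsScalarTower.toAlgHom F B C) n x) =
      algebraMap B C (formCoord B i J x) := by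
  induction x using form_induction with
  | hD b =>
    rw [formMap_ιMulti_D]
    simp only [formCoord, LinearMap.comp_apply, exteriorPower.map_apply_ιMulti,
      exteriorPower.ιMultiDual_apply_ιMulti, RingHom.map_det]
    congr 1
    ext p q
    simp [extendCoord_extendCoord]
  | hadd x y hx hy => simp only [map_add, hx, hy]
  | hsmul a x hx => simp [map_smulₛₗ, hx, Algebra.smul_def]

/-- The image in `⋀ⁿ Ω_{A/F}` of a standard basis element of `⋀ⁿ Aᵈ` under a linear map
`p : Aᵈ → Ω_{A/F}`. If `p` is a retraction of `i`, these forms and the coordinates `formCoord`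
with respect to `i` form a dual basis (`sum_formCoord`). -/
def formGen {d : ℕ} (p : (Fin d → A) →ₗ[A] Ω[A⁄F]) {n : ℕ}
    (J : Set.powersetCard (Fin d) n) : ⋀[A]^n (Ω[A⁄F]) :=
  exteriorPower.map n p ((Pi.basisFun A (Fin d)).exteriorPower n J)

lemma extendCoord_self {d : ℕ} (i : Ω[A⁄F] →ₗ[A] (Fin d → A)) : extendCoord A i = i := by
  apply LinearMap.ext_on_range (span_range_derivation F A)
  intro a
  ext j
  simpa using extendCoord_D (B := A) i a j

lemma sum_formCoord_self {d : ℕ} {i : Ω[A⁄F] →ₗ[A] (Fin d → A)}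
    {p : (Fin d → A) →ₗ[A] Ω[A⁄F]} (hpi : p ∘ₗ i = LinearMap.id) {n : ℕ}
    (x : ⋀[A]^n (Ω[A⁄F])) : ∑ J, formCoord A i J x • formGen p J = x := by
  have h : exteriorPower.map n p (exteriorPower.map n i x) = x := by
    rw [← LinearMap.comp_apply, ← exteriorPower.map_comp, hpi, exteriorPower.map_id]
    rfl
  conv_rhs => rw [← h, ← ((Pi.basisFun A (Fin d)).exteriorPower n).sum_repr
    (exteriorPower.map n i x)]
  simp only [map_sum, map_smul, formGen, formCoord, extendCoord_self,
    exteriorPower.basis_repr_apply, LinearMap.comp_apply]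

/-- A form on a formally étale `A`-algebra `B` is recovered from its coordinates. -/
lemma sum_formCoord [Algebra.FormallyEtale A B] {d : ℕ} {i : Ω[A⁄F] →ₗ[A] (Fin d → A)}
    {p : (Fin d → A) →ₗ[A] Ω[A⁄F]} (hpi : p ∘ₗ i = LinearMap.id) {n : ℕ}
    (y : ⋀[B]^n (Ω[B⁄F])) :
    ∑ J, formCoord B i J y • formMap (IsScalarTower.toAlgHom F A B) n (formGen p J) = y := by
  have hy : y ∈ Submodule.span B (Set.range fun a : Fin n → A =>
      exteriorPower.ιMulti B n fun i => D F B (algebraMap A B (a i))) := by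
    have := exteriorPower.ιMulti_span_of_span B n _ (span_D_algebraMap (F := F) (A := A) (B := B))
    rw [eq_top_iff] at this
    refine Submodule.span_mono ?_ (this (Submodule.mem_top (x := y)))
    rintro _ ⟨v, hv, rfl⟩
    choose a ha using fun i => hv ⟨i, rfl⟩
    exact ⟨a, by simp only [ha]⟩
  induction hy using Submodule.span_induction with
  | mem x h =>
    obtain ⟨a, rfl⟩ := h
    have h1 := formMap_ιMulti_D (IsScalarTower.toAlgHom F A B) n a
    simp only [IsScalarTower.coe_toAlgHom'] at h1
    simp only [← h1, formCoord_formMap]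
    conv_rhs => rw [← sum_formCoord_self hpi (exteriorPower.ιMulti A n fun i => D F A (a i))]
    simp [map_sum, map_smulₛₗ]
  | zero => simp
  | add x y _ _ hx hy =>
    conv_rhs => rw [← hx, ← hy]
    simp only [map_add, add_smul, Finset.sum_add_distrib]
  | smul b x _ hx =>
    conv_rhs => rw [← hx]
    simp only [map_smul, smul_assoc, Finset.smul_sum]

/-- A form on a formally étale `A`-algebra comes from `A` as soon as its coordinates do. -/
lemma mem_range_formMap_of_formCoord [Algebra.FormallyEtale A B] {d : ℕ}
    {i : Ω[A⁄F] →ₗ[A] (Fin d → A)}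
    {p : (Fin d → A) →ₗ[A] Ω[A⁄F]} (hpi : p ∘ₗ i = LinearMap.id) {n : ℕ}
    (y : ⋀[B]^n (Ω[B⁄F]))
    (hy : ∀ J, formCoord B i J y ∈ Set.range (algebraMap A B)) :
    y ∈ Set.range (formMap (IsScalarTower.toAlgHom F A B) n) := by
  choose a ha using hy
  refine ⟨∑ J, a J • formGen p J, ?_⟩
  conv_rhs => rw [← sum_formCoord hpi y]
  simp [map_sum, map_smulₛₗ, ha]

/-- If `Ω_{A/F}` is finite projective and `A → B` is formally étale and injective, then forms
on `A` embed into forms on `B`. -/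
lemma formMap_injective [Algebra.FormallyEtale A B] [Module.Finite A (Ω[A⁄F])]
    [Module.Projective A (Ω[A⁄F])] (h : Function.Injective (algebraMap A B)) (n : ℕ) :
    Function.Injective (formMap (IsScalarTower.toAlgHom F A B) n) := by
  obtain ⟨d, p, i, -, -, hpi⟩ := Module.Finite.exists_comp_eq_id_of_projective A (Ω[A⁄F])
  rw [injective_iff_map_eq_zero]
  intro x hx
  rw [← sum_formCoord_self hpi x]
  refine Finset.sum_eq_zero fun J _ => ?_
  have h1 := formCoord_formMap (C := B) i J x
  rw [hx, map_zero] at h1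
  rw [h (h1.symm.trans (map_zero _).symm), zero_smul]

end Forms

/-! ### Forms and monogenic extensions -/

/-- If a module `M` is generated by a submodule spanned by `s` together with one element `τ`, and
`c τ` lies in the span of `s`, then `c` multiplies `⋀ⁿ M` into the span of the products of
elements of `s`, because `τ` can occur at most once in a nonzero product. -/
lemma smul_mem_span_ιMulti {V M : Type*} [CommRing V] [AddCommGroup M] [Module V M]
    {s : Set M} {τ : M} {c : V} (htop : Submodule.span V (insert τ s) = ⊤)
    (hc : c • τ ∈ Submodule.span V s) {n : ℕ} (x : ⋀[V]^n M) :
    c • x ∈ Submodule.span V (exteriorPower.ιMulti V n '' {a | Set.range a ⊆ s}) := by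
  classical
  have hx : x ∈ Submodule.span V
      (exteriorPower.ιMulti V n '' {a | Set.range a ⊆ insert τ s}) := by
    rw [exteriorPower.ιMulti_span_of_span V n M htop]; trivial
  induction hx using Submodule.span_induction with
  | mem x h =>
    obtain ⟨v, hv, rfl⟩ := h
    by_cases h : ∃ j, v j ∉ s
    · obtain ⟨j, hj⟩ := h
      have hvj : v j = τ := (hv ⟨j, rfl⟩).resolve_right hj
      by_cases h' : ∃ l, l ≠ j ∧ v l ∉ s
      · obtain ⟨l, hlj, hl⟩ := h'
        have hvl : v l = τ := (hv ⟨l, rfl⟩).resolve_right hl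
        rw [(exteriorPower.ιMulti V n).map_eq_zero_of_eq v (hvl.trans hvj.symm) hlj, smul_zero]
        exact zero_mem _
      · push Not at h'
        have h1 : c • exteriorPower.ιMulti V n v =
            (exteriorPower.ιMulti V n).toMultilinearMap.toLinearMap v j (c • τ) := by
          rw [map_smul, ← hvj]
          simp
        rw [h1]
        refine Submodule.span_induction ?_ ?_ ?_ ?_ hc
        · intro y hy
          refine Submodule.subset_span ⟨Function.update v j y, ?_, rfl⟩
          rintro _ ⟨l, rfl⟩
          by_cases hl : l = j
          · subst hl; simpa using hy
          · simpa [hl] using h' l hl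
        · rw [map_zero]; exact zero_mem _
        · intro y z _ _ hy hz
          rw [map_add]; exact add_mem hy hz
        · intro a y _ hy
          rw [map_smul]; exact Submodule.smul_mem _ _ hy
    · push Not at h
      exact Submodule.smul_mem _ _ (Submodule.subset_span
        ⟨v, by rintro _ ⟨l, rfl⟩; exact h l, rfl⟩)
  | zero => rw [smul_zero]; exact zero_mem _
  | add x y _ _ hx hy => rw [smul_add]; exact add_mem hx hy
  | smul a x _ hx => rw [smul_comm]; exact Submodule.smul_mem _ _ hx

/-! ### Tamely ramified extensions of discrete valuation rings -/

section DVR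

variable {F R V : Type*} [Field F] [CommRing R] [CommRing V] [Algebra F V] [Algebra R V]

/-- The chain rule for a polynomial with coefficients in `R`, modulo differentials of elements
of `R`. -/
lemma D_aeval_sub_mem (y : V) (g : Polynomial R) :
    D F V (Polynomial.aeval y g) - Polynomial.aeval y (Polynomial.derivative g) • D F V y ∈
      Submodule.span V (Set.range fun r : R => D F V (algebraMap R V r)) := by
  induction g using Polynomial.induction_on' with
  | add p q hp hq =>
    simp only [map_add, add_smul]
    convert add_mem hp hq using 1
    abel
  | monomial n a =>
    have h : D F V (Polynomial.aeval y (Polynomial.monomial n a)) -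
        Polynomial.aeval y (Polynomial.derivative (Polynomial.monomial n a)) • D F V y =
        y ^ n • D F V (algebraMap R V a) := by
      rw [Polynomial.aeval_monomial, Polynomial.derivative_monomial, Polynomial.aeval_monomial,
        Derivation.leibniz, Derivation.leibniz_pow, map_mul, map_natCast]
      module
    rw [h]
    exact Submodule.smul_mem _ _ (Submodule.subset_span ⟨a, rfl⟩)

variable [IsDomain V]

/-- Let `R → V` be an extension of discrete valuation rings of residue characteristic zero with
separable residue field extension, and let `t = s ^ (e + 1) u` for uniformizers `t` of `R` and `s`
of `V`. Then `Ω_V` is generated by the differentials of elements of `R` together with one further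
element `τ = (e + 1) u ds + s du`, for which `s ^ e τ = dt`. -/
lemma exists_span_insert_eq_top [CharZero F] [IsDiscreteValuationRing V]
    [IsLocalHom (algebraMap R V)] [Algebra.EssFiniteType F V]
    (hinj : Function.Injective (algebraMap R V))
    (hres : ∀ y : V, ∃ g : Polynomial R, Polynomial.aeval y g ∈ IsLocalRing.maximalIdeal V ∧
      IsUnit (Polynomial.aeval y (Polynomial.derivative g)))
    {t : R} (ht : Irreducible t) :
    ∃ (s u : V) (e : ℕ) (τ : Ω[V⁄F]), Irreducible s ∧ algebraMap R V t = s ^ (e + 1) * u ∧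
      s ^ e • τ = D F V (algebraMap R V t) ∧
      Submodule.span V (insert τ (Set.range fun r : R => D F V (algebraMap R V r))) = ⊤ := by
  obtain ⟨s, hs⟩ := IsDiscreteValuationRing.exists_irreducible V
  have ht0 : algebraMap R V t ≠ 0 := by
    rw [Ne, map_eq_zero_iff _ hinj]; exact ht.ne_zero
  obtain ⟨e', u, hu⟩ := IsDiscreteValuationRing.eq_unit_mul_pow_irreducible ht0 hs
  obtain ⟨e, rfl⟩ : ∃ e, e' = e + 1 := by
    refine Nat.exists_eq_succ_of_ne_zero ?_
    rintro rfl
    rw [pow_zero, mul_one] at hu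
    exact ht.not_isUnit (isUnit_of_map_unit (algebraMap R V) _ (hu ▸ u.isUnit))
  have htu : algebraMap R V t = s ^ (e + 1) * (u : V) := by rw [hu, mul_comm]
  refine ⟨s, u, e, ((e + 1 : ℕ) * (u : V)) • D F V s + s • D F V (u : V), hs, htu, ?_, ?_⟩
  · rw [htu, Derivation.leibniz, Derivation.leibniz_pow, Nat.add_sub_cancel]
    module
  set τ := ((e + 1 : ℕ) * (u : V)) • D F V s + s • D F V (u : V) with hτ
  set N := Submodule.span V (insert τ (Set.range fun r : R => D F V (algebraMap R V r))) with hN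
  set P := N ⊔ IsLocalRing.maximalIdeal V • (⊤ : Submodule V (Ω[V⁄F])) with hP
  have hsm : s ∈ IsLocalRing.maximalIdeal V := (IsLocalRing.mem_maximalIdeal s).mpr hs.not_isUnit
  have hmP : ∀ (v : V) (x : Ω[V⁄F]), v ∈ IsLocalRing.maximalIdeal V → v • x ∈ P := fun v x hv =>
    Submodule.mem_sup_right (Submodule.smul_mem_smul hv trivial)
  have hspan : Submodule.span V (Set.range fun r : R => D F V (algebraMap R V r)) ≤ P :=
    (Submodule.span_mono (Set.subset_insert _ _)).trans le_sup_left
  -- Since `e + 1` is invertible in `F`, the element `τ` generates `ds` modulo `s`.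
  have hds : D F V s ∈ P := by
    have h1 : ((e + 1 : ℕ) * (u : V)) • D F V s ∈ P := by
      have : ((e + 1 : ℕ) * (u : V)) • D F V s = τ - s • D F V (u : V) := by rw [hτ]; abel
      rw [this]
      exact sub_mem (Submodule.mem_sup_left (Submodule.subset_span (Set.mem_insert _ _)))
        (hmP _ _ hsm)
    have h2 : IsUnit (((e + 1 : ℕ) : V) * (u : V)) := by
      refine IsUnit.mul ?_ u.isUnit
      have : ((e + 1 : ℕ) : V) = algebraMap F V ((e + 1 : ℕ) : F) := by simp
      rw [this]
      exact (IsUnit.mk0 _ (Nat.cast_ne_zero.mpr e.succ_ne_zero)).map _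
    exact (Submodule.smul_mem_iff_of_isUnit P h2).mp h1
  have hdm : ∀ v ∈ IsLocalRing.maximalIdeal V, D F V v ∈ P := by
    intro v hv
    rw [hs.maximalIdeal_eq, Ideal.mem_span_singleton'] at hv
    obtain ⟨a, rfl⟩ := hv
    rw [Derivation.leibniz]
    exact add_mem (Submodule.smul_mem _ _ hds) (hmP _ _ hsm)
  have hdy : ∀ y : V, D F V y ∈ P := by
    intro y
    obtain ⟨g, hg, hg'⟩ := hres y
    have h1 := sub_mem (hdm _ hg) (hspan (D_aeval_sub_mem (F := F) y g))
    rw [sub_sub_cancel] at h1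
    exact (Submodule.smul_mem_iff_of_isUnit P hg').mp h1
  have htop : (⊤ : Submodule V (Ω[V⁄F])) ≤ P := by
    rw [← span_range_derivation, Submodule.span_le]
    rintro _ ⟨y, rfl⟩
    exact hdy y
  exact top_le_iff.mp (Submodule.le_of_le_smul_of_le_jacobson_bot Module.Finite.fg_top
    (IsLocalRing.maximalIdeal_le_jacobson _) htop)

/-- The exponent of the denominators which appear when comparing forms on `V` with forms on `R` is
smaller than the ramification index. -/
lemma exists_smul_mem_span_formMap [CharZero F] [Algebra F R] [IsScalarTower F R V]
    [IsDiscreteValuationRing V] [IsLocalHom (algebraMap R V)] [Algebra.EssFiniteType F V]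
    (hinj : Function.Injective (algebraMap R V))
    (hres : ∀ y : V, ∃ g : Polynomial R, Polynomial.aeval y g ∈ IsLocalRing.maximalIdeal V ∧
      IsUnit (Polynomial.aeval y (Polynomial.derivative g)))
    {t : R} (ht : Irreducible t) :
    ∃ (s u : V) (e : ℕ), Irreducible s ∧ algebraMap R V t = s ^ (e + 1) * u ∧
      ∀ (n : ℕ) (x : ⋀[V]^n (Ω[V⁄F])), s ^ e • x ∈
        Submodule.span V (Set.range (formMap (IsScalarTower.toAlgHom F R V) n)) := by
  obtain ⟨s, u, e, τ, hs, htu, hτ, htop⟩ := exists_span_insert_eq_top (F := F) hinj hres ht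
  refine ⟨s, u, e, hs, htu, fun n x => ?_⟩
  refine Submodule.span_mono ?_ (smul_mem_span_ιMulti htop
    (by rw [hτ]; exact Submodule.subset_span ⟨t, rfl⟩) x)
  rintro _ ⟨v, hv, rfl⟩
  choose r hr using fun i => hv ⟨i, rfl⟩
  refine ⟨exteriorPower.ιMulti R n fun i => D F R (r i), ?_⟩
  rw [formMap_ιMulti_D]
  congr 1
  funext i
  exact hr i

/-- An element `a` of the fraction field of `R` lies in `R` if `s ^ e a` is integral, where
`e + 1` is the ramification index of `V` over `R`. -/
lemma mem_range_of_pow_mul_mem_range [IsDomain R] [IsDiscreteValuationRing R] {K L : Type*}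
    [Field K] [Field L] [Algebra R K] [IsFractionRing R K] [Algebra V L] [IsFractionRing V L]
    [Algebra K L] [Algebra R L]
    [IsScalarTower R K L] [IsScalarTower R V L]
    {t : R} (ht : Irreducible t) {s u : V} {e : ℕ} (hs : Irreducible s)
    (htu : algebraMap R V t = s ^ (e + 1) * u) {a : K}
    (ha : algebraMap V L (s ^ e) * algebraMap K L a ∈ Set.range (algebraMap V L)) :
    a ∈ Set.range (algebraMap R K) := by
  by_cases ha0 : a = 0
  · exact ⟨0, by rw [map_zero, ha0]⟩
  rcases ValuationRing.isInteger_or_isInteger R a with h | ⟨b, hb⟩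
  · exact h
  by_cases hbu : IsUnit b
  · obtain ⟨c, hc⟩ := hbu.exists_left_inv
    refine ⟨c, ?_⟩
    have : algebraMap R K c * algebraMap R K b = 1 := by rw [← map_mul, hc, map_one]
    rw [hb] at this
    field_simp at this
    exact this
  -- If `b = a⁻¹` is not a unit, it is divisible by `t`, hence `s ^ e = (s ^ e a) a⁻¹` by `s ^ (e + 1)`.
  · have hbm : b ∈ IsLocalRing.maximalIdeal R := hbu
    rw [ht.maximalIdeal_eq, Ideal.mem_span_singleton'] at hbm
    obtain ⟨c, rfl⟩ := hbm
    obtain ⟨v, hv⟩ := ha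
    exfalso
    have h1 : algebraMap V L (s ^ e) =
        algebraMap V L (v * (algebraMap R V c * (s ^ (e + 1) * u))) := by
      rw [← htu, ← map_mul, map_mul, hv, ← IsScalarTower.algebraMap_apply R V L,
        IsScalarTower.algebraMap_apply R K L, hb, mul_assoc, ← map_mul, mul_inv_cancel₀ ha0,
        map_one, mul_one]
    have h2 := IsFractionRing.injective V L h1
    have h3 : s ^ e * 1 = s ^ e * (s * (v * algebraMap R V c * u)) := by
      rw [mul_one]; conv_lhs => rw [h2]
      ring
    have h4 := mul_left_cancel₀ (pow_ne_zero e hs.ne_zero) h3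
    exact hs.not_isUnit (isUnit_of_dvd_one ⟨_, h4⟩)

end DVR

/-! ### Normal domains -/

section Normal

open TensorProduct

variable {A K : Type*} [CommRing A] [Field K] [Algebra A K]

/-- An element of `K` comes from `A` if it does so locally on `Spec A`. -/
lemma mem_range_of_forall_isMaximal {a : K}
    (h : ∀ p : Ideal A, p.IsMaximal → ∃ c ∉ p, c • a ∈ Set.range (algebraMap A K)) :
    a ∈ Set.range (algebraMap A K) := by
  let J : Ideal A :=
    Submodule.comap (LinearMap.toSpanSingleton A K a) (LinearMap.range (Algebra.linearMap A K))
  have hJ : J = ⊤ := by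
    by_contra hne
    obtain ⟨p, hp, hle⟩ := Ideal.exists_le_maximal J hne
    obtain ⟨c, hc, b, hb⟩ := h p hp
    exact hc (hle ⟨b, hb⟩)
  have h1 : (1 : A) ∈ J := hJ ▸ Submodule.mem_top
  obtain ⟨b, hb⟩ := h1
  exact ⟨b, by simpa using hb⟩

/-- A Noetherian normal domain is the intersection of those of its localizations at primes which
are discrete valuation rings: an associated prime of the class of `a` in `K ⧸ A` gives such a
localization not containing `a`. -/
lemma exists_isDiscreteValuationRing_of_notMem_range [IsDomain A] [IsNoetherianRing A]
    [IsIntegrallyClosed A] [IsFractionRing A K] {a : K}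
    (ha : a ∉ Set.range (algebraMap A K)) :
    ∃ (p : Ideal A) (_ : p.IsPrime), IsDiscreteValuationRing (Localization.AtPrime p) ∧
      ∀ c ∉ p, c • a ∉ Set.range (algebraMap A K) := by
  let N : Submodule A K := LinearMap.range (Algebra.linearMap A K)
  have hN : ∀ x : K, x ∈ N ↔ x ∈ Set.range (algebraMap A K) := fun x => Iff.rfl
  have hne : N.mkQ a ≠ 0 := by
    rw [Submodule.mkQ_apply, Ne, Submodule.Quotient.mk_eq_zero]; exact ha
  obtain ⟨p, hp, hle⟩ := exists_le_isAssociatedPrime_of_isNoetherianRing A (N.mkQ a) hne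
  rw [isAssociatedPrime_iff] at hp
  obtain ⟨hpp, x, hx⟩ := hp
  obtain ⟨b, rfl⟩ := N.mkQ_surjective x
  have hmem : ∀ c, c ∈ p ↔ c • b ∈ N := by
    intro c
    rw [hx, Submodule.mem_colon_singleton, ← map_smul, Submodule.mem_bot, Submodule.mkQ_apply,
      Submodule.Quotient.mk_eq_zero]
  refine ⟨p, hpp, ?_, fun c hc h => hc (hle ?_)⟩
  swap
  · rw [Submodule.mem_colon_singleton, ← map_smul, Submodule.mem_bot, Submodule.mkQ_apply,
      Submodule.Quotient.mk_eq_zero]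
    exact h
  have hinj := IsFractionRing.injective A K
  have hbN : b ∉ N := fun h => hpp.ne_top ((Ideal.eq_top_iff_one _).mpr ((hmem 1).mpr (by simpa)))
  have hp0 : p ≠ ⊥ := by
    rintro rfl
    obtain ⟨r, s, hs, rfl⟩ := IsFractionRing.div_surjective A b
    refine nonZeroDivisors.ne_zero hs ((hmem s).mpr ⟨r, ?_⟩)
    have : algebraMap A K s ≠ 0 := by
      rw [Ne, map_eq_zero_iff _ hinj]; exact nonZeroDivisors.ne_zero hs
    rw [Algebra.smul_def, Algebra.linearMap_apply]
    field_simp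
  -- If `b p ⊆ p`, then `b` would be integral over `A`.
  obtain ⟨x, hxp, y, hy, hyx⟩ : ∃ x ∈ p, ∃ y ∉ p, algebraMap A K y = x • b := by
    by_contra! hcon
    refine hbN ((hN b).mpr (IsIntegrallyClosed.isIntegral_iff.mp ?_))
    refine isIntegral_of_smul_mem_submodule (Submodule.map (Algebra.linearMap A K) p) ?_ ?_ b ?_
    · rw [← Submodule.map_bot (Algebra.linearMap A K)]
      exact (Submodule.map_injective_of_injective hinj).ne hp0
    · exact Submodule.FG.map _ (IsNoetherian.noetherian p)
    · rintro _ ⟨z, hz, rfl⟩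
      obtain ⟨w, hw⟩ := (hmem z).mp hz
      refine ⟨w, by_contra fun hwp => hcon z hz w hwp hw, ?_⟩
      rw [hw, Algebra.smul_def, smul_eq_mul, mul_comm]
      rfl
  have hx0 : x ≠ 0 := by
    rintro rfl
    rw [zero_smul, map_eq_zero_iff _ hinj] at hyx
    exact hy (hyx ▸ zero_mem _)
  -- Hence `b = y / x` with `y` a unit at `p`, and `x` generates the maximal ideal at `p`.
  have hdiv : ∀ z ∈ p, ∃ w, z * y = x * w := by
    intro z hz
    obtain ⟨w, hw⟩ := (hmem z).mp hz
    refine ⟨w, hinj ?_⟩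
    rw [Algebra.linearMap_apply] at hw
    rw [map_mul, map_mul, hyx, hw, Algebra.smul_def, Algebra.smul_def]
    ring
  have hnf : ¬ IsField (Localization.AtPrime p) :=
    IsLocalization.AtPrime.not_isField A hp0 _
  have : IsNoetherianRing (Localization.AtPrime p) :=
    IsLocalization.isNoetherianRing p.primeCompl _ inferInstance
  suffices h : (IsLocalRing.maximalIdeal (Localization.AtPrime p)).IsPrincipal from
    ((IsDiscreteValuationRing.TFAE (Localization.AtPrime p) hnf).out 0 4).mpr h
  refine ⟨⟨algebraMap A _ x, ?_⟩⟩
  rw [← Localization.AtPrime.map_eq_maximalIdeal]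
  apply le_antisymm
  · rw [Ideal.map_le_iff_le_comap]
    intro z hz
    obtain ⟨w, hw⟩ := hdiv z hz
    rw [Ideal.mem_comap]
    have hyu : IsUnit (algebraMap A (Localization.AtPrime p) y) :=
      IsLocalization.map_units _ (⟨y, hy⟩ : p.primeCompl)
    change _ ∈ Ideal.span _
    rw [← Ideal.mul_unit_mem_iff_mem _ hyu, ← map_mul, hw, map_mul]
    exact Ideal.mul_mem_right _ _ (Ideal.mem_span_singleton_self _)
  · rw [Submodule.span_singleton_le_iff_mem]
    exact Ideal.mem_map_of_mem _ hxp

/-- A domain `B` which is étale over a normal domain `P` is normal: taking integral closures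
commutes with the smooth base change `P → B`, and `B ⊗ Frac P` is the fraction field of `B`. -/
lemma isIntegrallyClosed_of_etale (P B : Type*) [CommRing P] [CommRing B] [IsDomain P]
    [IsDomain B] [IsIntegrallyClosed P] [Algebra P B] [Algebra.Etale P B] :
    IsIntegrallyClosed B := by
  have hflat : Module.Flat P B := inferInstance
  have hPB : Function.Injective (algebraMap P B) := FaithfulSMul.algebraMap_injective P B
  let K := FractionRing P
  let L := FractionRing B
  let g : K →ₐ[P] L := IsFractionRing.liftAlgHom (g := Algebra.ofId P L)
    (by
      change Function.Injective (algebraMap P L)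
      rw [IsScalarTower.algebraMap_eq P B L]
      exact (IsFractionRing.injective B L).comp hPB)
  let h : K ⊗[P] B →ₐ[P] L := Algebra.TensorProduct.productMap g (IsScalarTower.toAlgHom P B L)
  have h_tmul : ∀ (x : K) (b : B), h (x ⊗ₜ b) = g x * algebraMap B L b := fun x b => by
    simp [h]
  have h_inj : Function.Injective h := by
    rw [injective_iff_map_eq_zero]
    intro z hz
    obtain ⟨⟨b, s⟩, hb⟩ := IsLocalizedModule.surj (nonZeroDivisors P) (TensorProduct.mk P K B 1) z
    have h1 : h ((1 : K) ⊗ₜ b) = 0 := by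
      have : (1 : K) ⊗ₜ[P] b = (s : P) • z := hb.symm
      rw [this, map_smul, hz, smul_zero]
    rw [h_tmul, map_one, one_mul] at h1
    have hb0 : b = 0 := IsFractionRing.injective B L (by rw [h1, map_zero])
    have h2 : s • z = s • 0 := by rw [hb, hb0, map_zero, smul_zero]
    exact IsLocalizedModule.smul_injective (TensorProduct.mk P K B 1) s h2
  -- `K ⊗ B` is a domain which is finite over `K`, so it is all of `L`.
  have h_surj : Function.Surjective h := by
    have : Module.Finite K (K ⊗[P] B) := Algebra.FormallyUnramified.finite_of_free K (K ⊗[P] B)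
    have hdom : IsDomain (K ⊗[P] B) := h_inj.isDomain h
    have hfield : IsField (K ⊗[P] B) :=
      isField_of_isIntegral_of_isField' (R := K) (Field.toIsField K)
    intro x
    obtain ⟨r, s, hs, rfl⟩ := IsFractionRing.div_surjective B x
    have hs0 : (1 : K) ⊗ₜ[P] s ≠ 0 := by
      intro h0
      have := congrArg h h0
      rw [h_tmul, map_one, one_mul, map_zero] at this
      exact nonZeroDivisors.ne_zero hs (IsFractionRing.injective B L (by rw [this, map_zero]))
    obtain ⟨w, hw⟩ := hfield.mul_inv_cancel hs0
    refine ⟨(1 : K) ⊗ₜ r * w, ?_⟩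
    have h1 := congrArg h hw
    rw [map_mul, h_tmul, map_one, map_one, one_mul] at h1
    rw [map_mul, h_tmul, map_one, one_mul, eq_inv_of_mul_eq_one_right h1, div_eq_mul_inv]
  rw [isIntegrallyClosed_iff L]
  intro x hx
  let h' : B ⊗[P] K →ₐ[B] L := Algebra.TensorProduct.lift (Algebra.ofId B L) g
    (fun _ _ => Commute.all _ _)
  have hh' : ∀ y, h' y = h (TensorProduct.comm P B K y) := by
    intro y
    induction y with
    | zero => simp
    | add y z hy hz => simp only [map_add, hy, hz]
    | tmul b k =>
      simp only [TensorProduct.comm_tmul, h_tmul, h', Algebra.TensorProduct.lift_tmul]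
      exact mul_comm _ _
  have h'_inj : Function.Injective h' := by
    intro y z hyz
    rw [hh', hh'] at hyz
    exact (TensorProduct.comm P B K).injective (h_inj hyz)
  obtain ⟨y, rfl⟩ := h_surj x
  obtain ⟨y, rfl⟩ := (TensorProduct.comm P B K).surjective y
  rw [← hh'] at hx ⊢
  have hy : IsIntegral B y := (isIntegral_algHom_iff h' h'_inj).mp hx
  obtain ⟨w, hw⟩ := (TensorProduct.toIntegralClosure_bijective_of_smooth (R := P) (S := B)
    (B := K)).2 ⟨y, hy⟩
  have hw' : y = Algebra.TensorProduct.map (.id B B) (integralClosure P K).val w :=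
    (congrArg Subtype.val hw).symm
  rw [hw']
  clear hw hw' hy hx
  induction w with
  | zero => exact ⟨0, by simp⟩
  | add y z hy hz =>
    obtain ⟨b, hb⟩ := hy
    obtain ⟨c, hc⟩ := hz
    exact ⟨b + c, by simp only [map_add, hb, hc]⟩
  | tmul b c =>
    obtain ⟨q, hq⟩ := IsIntegrallyClosed.isIntegral_iff.mp c.2
    refine ⟨b * algebraMap P B q, ?_⟩
    simp only [Algebra.TensorProduct.map_tmul, h', Algebra.TensorProduct.lift_tmul, map_mul,
      Subalgebra.coe_val, ← hq, AlgHom.commutes]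
    rw [← IsScalarTower.algebraMap_apply]
    rfl

/-- A smooth domain over a field is normal, because it is locally étale over a polynomial ring. -/
lemma isIntegrallyClosed_of_smooth (F A : Type*) [Field F] [CommRing A] [IsDomain A]
    [Algebra F A] [Algebra.Smooth F A] : IsIntegrallyClosed A := by
  rw [isIntegrallyClosed_iff (FractionRing A)]
  intro x hx
  refine mem_range_of_forall_isMaximal fun p hp => ?_
  have hsm : Algebra.IsSmoothAt F p := inferInstance
  obtain ⟨f, hfp, n, i1, i2, i3⟩ :=
    Algebra.IsSmoothAt.exists_isStandardEtale_mvPolynomial (R := F) (p := p)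
  have hf0 : f ≠ 0 := fun h => hfp (h ▸ zero_mem _)
  have hle : Submonoid.powers f ≤ nonZeroDivisors A :=
    powers_le_nonZeroDivisors_of_noZeroDivisors hf0
  have : IsDomain (Localization.Away f) := IsLocalization.isDomain_localization hle
  have : IsIntegrallyClosed (Localization.Away f) :=
    isIntegrallyClosed_of_etale (MvPolynomial (Fin n) F) _
  let φ : Localization.Away f →+* FractionRing A := IsLocalization.lift (M := Submonoid.powers f)
    (g := algebraMap A (FractionRing A))
    (fun s => IsLocalization.map_units (M := nonZeroDivisors A) _ ⟨s, hle s.2⟩)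
  let _ : Algebra (Localization.Away f) (FractionRing A) := φ.toAlgebra
  have : IsScalarTower A (Localization.Away f) (FractionRing A) :=
    IsScalarTower.of_algebraMap_eq fun a => (IsLocalization.lift_eq _ a).symm
  have : IsFractionRing (Localization.Away f) (FractionRing A) :=
    IsFractionRing.isFractionRing_of_isDomain_of_isLocalization (Submonoid.powers f) _ _
  obtain ⟨b, hb⟩ := IsIntegrallyClosed.isIntegral_iff.mp (hx.tower_top (A := Localization.Away f))
  obtain ⟨⟨a, s⟩, hs⟩ := IsLocalization.surj (Submonoid.powers f) b
  obtain ⟨s, m, rfl⟩ := s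
  refine ⟨f ^ m, fun h => hfp (hp.isPrime.mem_of_pow_mem m h), a, ?_⟩
  have := congrArg (algebraMap _ (FractionRing A)) hs
  rw [map_mul, hb, ← IsScalarTower.algebraMap_apply, ← IsScalarTower.algebraMap_apply] at this
  rw [← this, Algebra.smul_def, mul_comm]

end Normal

/-! ### Forms that are regular on all valuation rings -/

section Core

universe u

open IsLocalRing in
/-- Every element of `V` satisfies, modulo the maximal ideal, a separable polynomial over `R`. -/
lemma exists_aeval_mem_maximalIdeal {R V : Type*} [CommRing R] [CommRing V] [IsLocalRing R]
    [IsLocalRing V] [Algebra R V] [IsLocalHom (algebraMap R V)] [CharZero (ResidueField R)]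
    [Algebra.IsAlgebraic (ResidueField R) (ResidueField V)] (y : V) :
    ∃ g : Polynomial R, Polynomial.aeval y g ∈ maximalIdeal V ∧
      IsUnit (Polynomial.aeval y (Polynomial.derivative g)) := by
  have hint : IsIntegral (ResidueField R) (residue V y) :=
    (Algebra.IsAlgebraic.isAlgebraic _).isIntegral
  have hsep : (minpoly (ResidueField R) (residue V y)).Separable :=
    (minpoly.irreducible hint).separable
  obtain ⟨g, hg⟩ := Polynomial.map_surjective (residue R) residue_surjective
    (minpoly (ResidueField R) (residue V y))
  have key : ∀ f : Polynomial R, residue V (Polynomial.aeval y f) =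
      Polynomial.aeval (residue V y) (f.map (residue R)) := by
    intro f
    rw [Polynomial.aeval_def, Polynomial.hom_eval₂, Polynomial.aeval_def, Polynomial.eval₂_map]
    rfl
  refine ⟨g, ?_, ?_⟩
  · rw [← residue_eq_zero_iff, key, hg, minpoly.aeval]
  · rw [← residue_ne_zero_iff_isUnit, key, ← Polynomial.derivative_map, hg]
    exact hsep.aeval_derivative_ne_zero (minpoly.aeval _ _)

open IsLocalRing in
lemma isAlgebraic_residueField {R C V : Type*} [CommRing R] [CommRing C] [CommRing V]
    [IsLocalRing R] [IsLocalRing V] [Algebra R C] [Algebra C V] [Algebra R V] [IsScalarTower R C V]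
    [Algebra.IsIntegral R C] (P : Ideal C) [P.IsMaximal] [IsLocalization.AtPrime V P]
    [IsLocalHom (algebraMap R V)] :
    Algebra.IsAlgebraic (ResidueField R) (ResidueField V) := by
  refine ⟨fun x => ?_⟩
  obtain ⟨y, rfl⟩ := residue_surjective x
  obtain ⟨c, hc⟩ : ∃ c : C, residue V (algebraMap C V c) = residue V y := by
    obtain ⟨c, hc⟩ := (IsLocalization.AtPrime.equivQuotMaximalIdeal P V).surjective (residue V y)
    obtain ⟨c, rfl⟩ := Ideal.Quotient.mk_surjective c
    exact ⟨c, hc⟩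
  rw [← hc]
  have h1 : IsIntegral R (algebraMap C (ResidueField V) c) :=
    (Algebra.IsIntegral.isIntegral (R := R) c).map
      (IsScalarTower.toAlgHom R C (ResidueField V))
  exact (h1.tower_top (A := ResidueField R)).isAlgebraic

/-- Coordinates on `L` of forms on `V` that are linear combinations of forms on `R` lie in `V`,
because those of forms on `R` lie in `R`. -/
lemma formCoord_mem_range_of_mem_span {F A R V L : Type*} [CommRing F] [CommRing A]
    [CommRing R] [CommRing V] [CommRing L] [Algebra F A] [Algebra F R] [Algebra F V] [Algebra F L]
    [Algebra A R] [Algebra A L] [Algebra R V] [Algebra R L] [Algebra V L]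
    [IsScalarTower F A R] [IsScalarTower F A L] [IsScalarTower F R V] [IsScalarTower F R L]
    [IsScalarTower F V L] [IsScalarTower A R L] [IsScalarTower R V L]
    [Algebra.FormallyEtale A R] [Algebra.FormallyEtale A L] {d : ℕ}
    (i : Ω[A⁄F] →ₗ[A] (Fin d → A)) {n : ℕ} (J : Set.powersetCard (Fin d) n)
    {y : ⋀[V]^n (Ω[V⁄F])}
    (hy : y ∈ Submodule.span V (Set.range (formMap (IsScalarTower.toAlgHom F R V) n))) :
    formCoord L i J (formMap (IsScalarTower.toAlgHom F V L) n y) ∈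
      Set.range (algebraMap V L) := by
  induction hy using Submodule.span_induction with
  | mem y h =>
    obtain ⟨z, rfl⟩ := h
    have hcomp : (IsScalarTower.toAlgHom F V L).comp (IsScalarTower.toAlgHom F R V) =
        IsScalarTower.toAlgHom F R L :=
      AlgHom.ext fun r => (IsScalarTower.algebraMap_apply R V L r).symm
    rw [← formMap_comp, hcomp, formCoord_formMap, IsScalarTower.algebraMap_apply R V L]
    exact ⟨_, rfl⟩
  | zero => exact ⟨0, by simp⟩
  | add y z _ _ hy hz =>
    obtain ⟨b, hb⟩ := hy
    obtain ⟨c, hc⟩ := hz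
    exact ⟨b + c, by simp only [map_add, hb, hc]⟩
  | smul v y _ hy =>
    obtain ⟨b, hb⟩ := hy
    refine ⟨v * b, ?_⟩
    rw [map_smulₛₗ, map_smul, ← hb, map_mul, smul_eq_mul]
    rfl

variable {F A R : Type*} {K L : Type u} [Field F] [CharZero F] [CommRing A]
  [CommRing R] [Field K] [Field L] [Algebra F A] [Algebra F R] [Algebra F K] [Algebra F L]
  [Algebra A R] [Algebra A K] [Algebra A L] [Algebra R K] [Algebra R L] [Algebra K L]
  [IsScalarTower F A R] [IsScalarTower F A K] [IsScalarTower F A L]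
  [IsScalarTower F R L] [IsScalarTower F K L] [IsScalarTower A R L] [IsScalarTower A K L]
  [IsScalarTower R K L]

/-- The coordinates of a form on `K = Frac R`, with `R` a discrete valuation ring, lie in `R` if
the pull-back of the form to a finite extension `L` of `K` is regular on all valuation rings
of `L`. -/
lemma formCoord_mem_range_of_valuation [IsDomain R] [IsDiscreteValuationRing R]
    [IsFractionRing R K] [FiniteDimensional K L]
    [Algebra.FormallyEtale A R] [Algebra.FormallyEtale A K] [Algebra.FormallyEtale A L]
    [Algebra.EssFiniteType F R] {d : ℕ} (i : Ω[A⁄F] →ₗ[A] (Fin d → A)) {n : ℕ}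
    (J : Set.powersetCard (Fin d) n) (ω : ⋀[K]^n (Ω[K⁄F]))
    (hV : ∀ (V : Type u) [CommRing V] [IsDomain V] [ValuationRing V] [Algebra F V] [Algebra A V]
      [Algebra V L] [IsScalarTower F V L] [IsScalarTower A V L] [IsFractionRing V L],
      formMap (IsScalarTower.toAlgHom F K L) n ω ∈
        Set.range (formMap (IsScalarTower.toAlgHom F V L) n)) :
    formCoord K i J ω ∈ Set.range (algebraMap R K) := by
  have : CharZero K := charZero_of_injective_algebraMap (algebraMap F K).injective
  have : CharZero (IsLocalRing.ResidueField R) :=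
    charZero_of_injective_algebraMap (algebraMap F (IsLocalRing.ResidueField R)).injective
  let C := integralClosure R L
  have hRL : Function.Injective (algebraMap R L) := by
    rw [IsScalarTower.algebraMap_eq R K L]
    exact (algebraMap K L).injective.comp (IsFractionRing.injective R K)
  have hRC : Function.Injective (algebraMap R C) := by
    intro a b hab
    exact hRL (by rw [IsScalarTower.algebraMap_apply R C L, hab, ← IsScalarTower.algebraMap_apply])
  have : Module.Finite R C := IsIntegralClosure.finite R K L C
  have : IsFractionRing C L := IsIntegralClosure.isFractionRing_of_finite_extension R K L C
  have : IsDedekindDomain C := IsIntegralClosure.isDedekindDomain R K L C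
  have : Algebra.IsIntegral R C := inferInstance
  obtain ⟨P, hP⟩ := Ideal.exists_maximal C
  have hcomap : P.comap (algebraMap R C) = IsLocalRing.maximalIdeal R :=
    IsLocalRing.eq_maximalIdeal (Ideal.isMaximal_comap_of_isIntegral_of_isMaximal P)
  have hP0 : P ≠ ⊥ := by
    rintro rfl
    apply IsDiscreteValuationRing.not_a_field R
    rw [← hcomap]
    exact (Ideal.comap_bot_of_injective _ hRC)
  -- `V` is the localization of `C` at `P`, as a subring of `L`; it is essentially of finite type
  -- over `F`, so that `Ω_V` is finitely generated.
  let V := Localization.subalgebra.ofField L P.primeCompl P.primeCompl_le_nonZeroDivisors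
  have hloc : IsLocalization.AtPrime V P :=
    Localization.subalgebra.isLocalization_ofField L P.primeCompl P.primeCompl_le_nonZeroDivisors
  have : IsDiscreteValuationRing V :=
    IsLocalization.AtPrime.isDiscreteValuationRing_of_dedekind_domain C hP0 V
  have hRV : Function.Injective (algebraMap R V) := by
    intro a b hab
    exact hRL (by rw [IsScalarTower.algebraMap_apply R V L, hab, ← IsScalarTower.algebraMap_apply])
  have : IsLocalHom (algebraMap R V) := by
    refine ⟨fun a ha => ?_⟩
    by_contra hna
    have h1 : a ∈ P.comap (algebraMap R C) := by
      rw [hcomap]; exact hna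
    have h2 := (IsLocalization.AtPrime.to_map_mem_maximal_iff V P (algebraMap R C a)).mpr h1
    rw [← IsScalarTower.algebraMap_apply] at h2
    exact h2 ha
  have : Algebra.IsAlgebraic (IsLocalRing.ResidueField R) (IsLocalRing.ResidueField V) :=
    isAlgebraic_residueField (C := C) P
  have : Algebra.EssFiniteType F C := Algebra.EssFiniteType.comp F R C
  have : Algebra.EssFiniteType C V := Algebra.EssFiniteType.of_isLocalization V P.primeCompl
  have : Algebra.EssFiniteType F V := Algebra.EssFiniteType.comp F C V
  obtain ⟨t, ht⟩ := IsDiscreteValuationRing.exists_irreducible R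
  obtain ⟨s, w, e, hs, htw, hmem⟩ := exists_smul_mem_span_formMap (F := F) hRV
    exists_aeval_mem_maximalIdeal ht
  let _ : Algebra A V := ((algebraMap R V).comp (algebraMap A R)).toAlgebra
  have : IsScalarTower A R V := IsScalarTower.of_algebraMap_eq fun _ => rfl
  have : IsScalarTower A V L := IsScalarTower.of_algebraMap_eq fun a => by
    rw [IsScalarTower.algebraMap_apply A R L, IsScalarTower.algebraMap_apply R V L,
      IsScalarTower.algebraMap_apply A R V]
  obtain ⟨x, hx⟩ := hV V
  refine mem_range_of_pow_mul_mem_range (V := V) (L := L) ht hs htw ?_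
  rw [← formCoord_formMap, ← hx]
  have h := formCoord_mem_range_of_mem_span (L := L) i J (hmem n x)
  rw [map_smulₛₗ, map_smul, smul_eq_mul] at h
  exact h

/-- Let `A` be a smooth domain with fraction field `K`. A form on `K` whose pull-back to a finite
extension `L` is regular on all valuation rings of `L` containing `A` comes from a form
on `A`. -/
theorem mem_range_formMap_of_valuation [IsDomain A] [Algebra.Smooth F A] [IsFractionRing A K]
    [FiniteDimensional K L] {n : ℕ} (ω : ⋀[K]^n (Ω[K⁄F]))
    (hV : ∀ (V : Type u) [CommRing V] [IsDomain V] [ValuationRing V] [Algebra F V] [Algebra A V]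
      [Algebra V L] [IsScalarTower F V L] [IsScalarTower A V L] [IsFractionRing V L],
      formMap (IsScalarTower.toAlgHom F K L) n ω ∈
        Set.range (formMap (IsScalarTower.toAlgHom F V L) n)) :
    ω ∈ Set.range (formMap (IsScalarTower.toAlgHom F A K) n) := by
  have : CharZero K := charZero_of_injective_algebraMap (algebraMap F K).injective
  have : IsNoetherianRing A := Algebra.FiniteType.isNoetherianRing F A
  have : IsIntegrallyClosed A := isIntegrallyClosed_of_smooth F A
  have : Algebra.FormallyEtale A K := .of_isLocalization (nonZeroDivisors A)
  have : Algebra.FormallyEtale K L := Algebra.FormallyEtale.of_isSeparable K L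
  have : Algebra.FormallyEtale A L := .comp A K L
  obtain ⟨d, p, i, -, -, hpi⟩ := Module.Finite.exists_comp_eq_id_of_projective A (Ω[A⁄F])
  refine mem_range_formMap_of_formCoord hpi ω fun J => ?_
  -- A coordinate outside `A` would lie outside a localization `R` of `A` that is a discrete
  -- valuation ring.
  by_contra hJ
  obtain ⟨q, hq, hdvr, hnot⟩ := exists_isDiscreteValuationRing_of_notMem_range hJ
  let R := Localization.subalgebra.ofField K q.primeCompl q.primeCompl_le_nonZeroDivisors
  have hloc : IsLocalization.AtPrime R q :=
    Localization.subalgebra.isLocalization_ofField K q.primeCompl q.primeCompl_le_nonZeroDivisors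
  have : IsDiscreteValuationRing R :=
    IsDiscreteValuationRing.RingEquivClass.isDiscreteValuationRing
      (IsLocalization.algEquiv q.primeCompl (Localization.AtPrime q) R)
  have : Algebra.FormallyEtale A R := .of_isLocalization q.primeCompl
  have : Algebra.EssFiniteType A R := Algebra.EssFiniteType.of_isLocalization R q.primeCompl
  have : Algebra.EssFiniteType F R := Algebra.EssFiniteType.comp F A R
  have : IsScalarTower F R L := IsScalarTower.of_algebraMap_eq fun a => by
    rw [IsScalarTower.algebraMap_apply F K L, IsScalarTower.algebraMap_apply F R K,
      IsScalarTower.algebraMap_apply R K L]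
  have : IsScalarTower A R L := IsScalarTower.of_algebraMap_eq fun a => by
    rw [IsScalarTower.algebraMap_apply A K L, IsScalarTower.algebraMap_apply A R K,
      IsScalarTower.algebraMap_apply R K L]
  obtain ⟨r, hr⟩ := formCoord_mem_range_of_valuation (R := R) i J ω hV
  obtain ⟨⟨a, s⟩, has⟩ := IsLocalization.surj q.primeCompl r
  refine hnot s s.2 ⟨a, ?_⟩
  have h := congrArg (algebraMap R K) has
  rw [map_mul, hr, ← IsScalarTower.algebraMap_apply, ← IsScalarTower.algebraMap_apply] at h
  rw [← h, Algebra.smul_def, mul_comm]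

end Core

/-! ### Regular forms on smooth schemes -/

section Local

variable {X : Scheme.{0}} [X.Over SpecC]

lemma formMap_congr {R A B : Type*} [CommRing R] [CommRing A] [CommRing B] [Algebra R A]
    [Algebra R B] {φ ψ : A →ₐ[R] B} (h : ∀ a, φ a = ψ a) {n : ℕ} (x : ⋀[A]^n (Ω[A⁄R])) :
    formMap φ n x = formMap ψ n x := by
  obtain rfl : φ = ψ := AlgHom.ext h
  rfl

lemma smooth_sections [Smooth (X ↘ SpecC)] {U : X.Opens} (hU : IsAffineOpen U) :
    Algebra.Smooth ℂ Γ(X, U) := by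
  have h1 : RingHom.Smooth ((X ↘ SpecC).appLE ⊤ U le_top).hom :=
    HasRingHomProperty.appLE @Smooth (X ↘ SpecC) inferInstance ⟨⊤, isAffineOpen_top _⟩ ⟨U, hU⟩ _
  have h2 := (RingHom.Smooth.respectsIso).2 _
    (Scheme.ΓSpecIso (CommRingCat.of ℂ)).symm.commRingCatIsoToRingEquiv h1
  have h3 : ((X ↘ SpecC).appLE ⊤ U le_top).hom.comp
      (Scheme.ΓSpecIso (CommRingCat.of ℂ)).symm.commRingCatIsoToRingEquiv.toRingHom =
      algebraMap ℂ Γ(X, U) := by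
    change _ = (scalars X ≫ X.presheaf.map (homOfLE le_top).op).hom
    rw [scalars, Category.assoc]
    rfl
  exact RingHom.smooth_algebraMap.mp (h3 ▸ h2)

variable [IsIntegral X]

instance isScalarTower_functionField (U : X.Opens) [Nonempty U] :
    IsScalarTower ℂ Γ(X, U) X.functionField :=
  IsScalarTower.of_algebraMap_eq fun r =>
    ((germ X U (genericPoint X) (genericPoint_mem X U (Set.nonempty_coe_sort.mp ‹_›))).commutes
      r).symm

lemma formMap_germ (U : X.Opens) [Nonempty U] (hη : genericPoint X ∈ U) {n : ℕ}
    (x : ⋀[Γ(X, U)]^n (Ω[Γ(X, U)⁄ℂ])) :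
    formMap (germ X U (genericPoint X) hη) n x =
      formMap (IsScalarTower.toAlgHom ℂ Γ(X, U) X.functionField) n x :=
  formMap_congr (fun _ => rfl) x

/-- A meromorphic form which is regular near each point of `X` is, for every nonempty affine open
subset `U`, the germ of a form on `U`. -/
lemma mem_range_formMap_germ [Smooth (X ↘ SpecC)] {n : ℕ} (ω : MeromorphicForm X n)
    (h : ∀ x : X, ∃ (U : X.Opens) (_ : IsAffineOpen U) (_ : x ∈ U) (hη : genericPoint X ∈ U),
      ω ∈ Set.range (formMap (germ X U (genericPoint X) hη) n))
    {U : X.Opens} (hU : IsAffineOpen U) (hη : genericPoint X ∈ U) :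
    ω ∈ Set.range (formMap (germ X U (genericPoint X) hη) n) := by
  have hne : Nonempty U := ⟨⟨_, hη⟩⟩
  have := smooth_sections hU
  have := functionField_isFractionRing_of_isAffineOpen X U hU
  have : Algebra.FormallyEtale Γ(X, U) X.functionField :=
    .of_isLocalization (nonZeroDivisors Γ(X, U))
  obtain ⟨d, p, i, -, -, hpi⟩ :=
    Module.Finite.exists_comp_eq_id_of_projective Γ(X, U) (Ω[Γ(X, U)⁄ℂ])
  suffices ω ∈ Set.range (formMap (IsScalarTower.toAlgHom ℂ Γ(X, U) X.functionField) n) by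
    obtain ⟨y, rfl⟩ := this
    exact ⟨y, formMap_germ U hη y⟩
  refine mem_range_formMap_of_formCoord hpi ω fun J => mem_range_of_forall_isMaximal fun q hq => ?_
  let x : X := hU.fromSpec ⟨q, hq.isPrime⟩
  have hxU : x ∈ U := by
    rw [← SetLike.mem_coe, ← hU.range_fromSpec]
    exact ⟨_, rfl⟩
  obtain ⟨U', hU', hxU', hη', η', hη'ω⟩ := h x
  obtain ⟨f, hfU', hxf⟩ := hU.exists_basicOpen_le ⟨x, hxU'⟩ hxU
  have hfq : f ∉ q := by
    have h1 : (⟨q, hq.isPrime⟩ : PrimeSpectrum Γ(X, U)) ∈ hU.fromSpec ⁻¹ᵁ X.basicOpen f := hxf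
    rw [hU.fromSpec_preimage_basicOpen] at h1
    exact h1
  have hηf : genericPoint X ∈ X.basicOpen f := genericPoint_mem X _ ⟨x, hxf⟩
  have hnef : Nonempty (X.basicOpen f) := ⟨⟨_, hηf⟩⟩
  have := hU.isLocalization_basicOpen f
  have : IsScalarTower ℂ Γ(X, U) Γ(X, X.basicOpen f) :=
    IsScalarTower.of_algebraMap_eq fun r => ((res X (X.basicOpen_le f)).commutes r).symm
  have : IsScalarTower Γ(X, U) Γ(X, X.basicOpen f) X.functionField :=
    IsScalarTower.of_algebraMap_eq fun r => by
      exact (X.presheaf.germ_res_apply (homOfLE (X.basicOpen_le f)) (genericPoint X) hηf r).symm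
  have : Algebra.FormallyEtale Γ(X, U) Γ(X, X.basicOpen f) :=
    .of_isLocalization (Submonoid.powers f)
  have hω : ω = formMap (IsScalarTower.toAlgHom ℂ Γ(X, X.basicOpen f) X.functionField) n
      (formMap (res X hfU') n η') := by
    rw [← hη'ω, ← formMap_comp]
    refine formMap_congr (fun a => ?_) _
    exact (X.presheaf.germ_res_apply (homOfLE hfU') (genericPoint X) hηf a).symm
  rw [hω, formCoord_formMap]
  obtain ⟨⟨a, s⟩, hs⟩ := IsLocalization.surj (Submonoid.powers f)
    (formCoord Γ(X, X.basicOpen f) i J (formMap (res X hfU') n η'))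
  obtain ⟨s, m, rfl⟩ := s
  refine ⟨f ^ m, fun h => hfq (hq.isPrime.mem_of_pow_mem m h), a, ?_⟩
  have := congrArg (algebraMap _ X.functionField) hs
  rw [map_mul, ← IsScalarTower.algebraMap_apply, ← IsScalarTower.algebraMap_apply] at this
  rw [← this, Algebra.smul_def, mul_comm]

/-- On a smooth integral scheme, regularity of a meromorphic form is a local property. -/
lemma isRegular_iff_forall_exists [Smooth (X ↘ SpecC)] {n : ℕ} (ω : MeromorphicForm X n) :
    IsRegular ω ↔
      ∀ x : X, ∃ (U : X.Opens) (_ : IsAffineOpen U) (_ : x ∈ U) (hη : genericPoint X ∈ U),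
        ω ∈ Set.range (formMap (germ X U (genericPoint X) hη) n) := by
  constructor
  · rintro ⟨η, hη⟩ x
    obtain ⟨U, hU, hxU, -⟩ := exists_isAffineOpen_mem_and_subset (x := x) (U := ⊤) trivial
    exact ⟨U, hU, hxU, genericPoint_mem X U ⟨x, hxU⟩, η.val ⟨U, hU⟩, hη ⟨U, hU⟩ ⟨x, hxU⟩⟩
  · intro h
    classical
    have hex : ∀ U : X.affineOpens, ∃ y : ⋀[Γ(X, U)]^n (Ω[Γ(X, U)⁄ℂ]),
        ∀ hη : genericPoint X ∈ (U : X.Opens),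
          formMap (germ X U (genericPoint X) hη) n y = ω := by
      intro U
      by_cases hη : genericPoint X ∈ (U : X.Opens)
      · obtain ⟨y, hy⟩ := mem_range_formMap_germ ω h U.2 hη
        exact ⟨y, fun _ => hy⟩
      · exact ⟨0, fun h => absurd h hη⟩
    choose val hval using hex
    refine ⟨⟨val, fun U V hUV => ?_⟩, fun U hU => hval U _⟩
    by_cases hη : genericPoint X ∈ (U : X.Opens)
    · have hne : Nonempty (U : X.Opens) := ⟨⟨_, hη⟩⟩
      have := smooth_sections U.2
      have := functionField_isFractionRing_of_isAffineOpen X _ U.2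
      have : Algebra.FormallyEtale Γ(X, U) X.functionField :=
        .of_isLocalization (nonZeroDivisors Γ(X, U))
      apply formMap_injective (F := ℂ) (A := Γ(X, U)) (B := X.functionField)
        (IsFractionRing.injective Γ(X, U) X.functionField)
      rw [← formMap_germ (U : X.Opens) hη, ← formMap_germ (U : X.Opens) hη, hval U hη,
        ← formMap_comp, ← hval V (hUV hη)]
      refine formMap_congr (fun a => ?_) _
      exact X.presheaf.germ_res_apply (homOfLE hUV) (genericPoint X) hη a
    -- On the empty set there is nothing to check: its ring of functions is zero.
    · have hbot : (U : X.Opens) = ⊥ := by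
        by_contra hne
        exact hη (genericPoint_mem X _ ((TopologicalSpace.Opens.ne_bot_iff_nonempty _).mp hne))
      have hs : Subsingleton Γ(X, U) := by
        rw [hbot]
        infer_instance
      have := Module.subsingleton Γ(X, U) (⋀[Γ(X, U)]^n (Ω[Γ(X, U)⁄ℂ]))
      exact Subsingleton.elim _ _

end Local

/-! ### Pull-back along dominant morphisms -/

section Pullback

variable {Z W : Scheme.{0}} [Z.Over SpecC] [W.Over SpecC] (g : Z ⟶ W) [g.IsOver SpecC]

/-- Pull-back of functions, as a homomorphism of `ℂ`-algebras. -/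
def pullbackSections (U : W.Opens) (U' : Z.Opens) (h : U' ≤ g ⁻¹ᵁ U) :
    Γ(W, U) →ₐ[ℂ] Γ(Z, U') :=
  { (g.appLE U U' h).hom with
    commutes' := fun r => by
      change (g.appLE U U' h).hom ((scalars W ≫ W.presheaf.map (homOfLE le_top).op).hom r) =
        (scalars Z ≫ Z.presheaf.map (homOfLE le_top).op).hom r
      rw [← CommRingCat.comp_apply]
      congr 2
      have hs : scalars W ≫ g.appTop = scalars Z := by
        simp only [scalars, Category.assoc]
        rw [← Scheme.Hom.comp_appTop, comp_over]
      rw [← hs, Category.assoc, Category.assoc, Scheme.Hom.map_appLE]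
      rfl }

variable [IsIntegral Z] [IsIntegral W]

section

variable [IsDominant g]

lemma germ_pullbackSections (U : W.Opens) (U' : Z.Opens) (h : U' ≤ g ⁻¹ᵁ U)
    (hη : genericPoint W ∈ U) (hη' : genericPoint Z ∈ U') (a : Γ(W, U)) :
    germ Z U' (genericPoint Z) hη' (pullbackSections g U U' h a) =
      functionFieldMap g (germ W U (genericPoint W) hη a) := by
  change (g.appLE U U' h ≫ Z.presheaf.germ U' (genericPoint Z) hη').hom a =
    (W.presheaf.germ U (genericPoint W) hη ≫
      W.presheaf.stalkSpecializes (specializes_of_eq (map_genericPoint g)) ≫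
      g.stalkMap (genericPoint Z)).hom a
  congr 2
  rw [TopCat.Presheaf.germ_stalkSpecializes_assoc, Scheme.Hom.germ_stalkMap, Scheme.Hom.appLE,
    Category.assoc, TopCat.Presheaf.germ_res]

/-- A generically étale morphism induces a finite extension of function fields: the extension is
unramified and essentially of finite type. -/
lemma GenericallyEtale.finite_functionFieldMap (hg : GenericallyEtale g) :
    (functionFieldMap g : W.functionField →+* Z.functionField).Finite := by
  obtain ⟨O, hO, hOg⟩ := hg
  have hηO : genericPoint Z ∈ O := genericPoint_mem Z O hO.nonempty
  obtain ⟨U, hU, hηU, -⟩ :=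
    exists_isAffineOpen_mem_and_subset (x := g (genericPoint Z)) (U := ⊤) trivial
  obtain ⟨U', hU', hηU', hle⟩ := exists_isAffineOpen_mem_and_subset (x := genericPoint Z)
    (U := O ⊓ g ⁻¹ᵁ U) ⟨hηO, hηU⟩
  have hleO : U' ≤ O := fun x hx => (hle hx).1
  have hleU : U' ≤ g ⁻¹ᵁ U := fun x hx => (hle hx).2
  have hηW : genericPoint W ∈ U := map_genericPoint g ▸ hηU
  have het : Etale (U'.ι ≫ g) := by
    rw [← Z.homOfLE_ι hleO, Category.assoc]
    infer_instance
  have h1 : (g.appLE U U' hleU).hom.Etale := by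
    have haff : IsAffine U' := hU'
    have h2 : RingHom.Etale ((U'.ι ≫ g).appLE U ⊤ (fun x _ => hleU x.2)).hom :=
      HasRingHomProperty.appLE @Etale (U'.ι ≫ g) het ⟨U, hU⟩
        ⟨⊤, isAffineOpen_top (U' : Scheme)⟩ _
    have h3 : (U'.ι ≫ g).appLE U ⊤ (fun x _ => hleU x.2) = g.appLE U U' hleU ≫ U'.topIso.inv := by
      rw [← Scheme.Hom.appLE_comp_appLE U'.ι g U U' ⊤ hleU U'.ι_preimage_self.ge,
        Scheme.Opens.ι_appLE]
      rfl
    rw [h3] at h2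
    exact (RingHom.Etale.respectsIso.cancel_right_isIso _ _).mp h2
  have hne : Nonempty U := ⟨⟨_, hηW⟩⟩
  have hne' : Nonempty U' := ⟨⟨_, hηU'⟩⟩
  have := functionField_isFractionRing_of_isAffineOpen W U hU
  have := functionField_isFractionRing_of_isAffineOpen Z U' hU'
  algebraize [(g.appLE U U' hleU).hom, (functionFieldMap g : W.functionField →+* Z.functionField),
    ((functionFieldMap g : W.functionField →+* Z.functionField).comp
      (algebraMap Γ(W, U) W.functionField))]
  have : IsScalarTower Γ(W, U) Γ(Z, U') Z.functionField := IsScalarTower.of_algebraMap_eq fun a =>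
    (germ_pullbackSections g U U' hleU hηW hηU' a).symm
  have : Algebra.FormallyEtale Γ(Z, U') Z.functionField :=
    .of_isLocalization (nonZeroDivisors Γ(Z, U'))
  have : Algebra.FormallyUnramified Γ(W, U) Z.functionField := .comp _ Γ(Z, U') _
  have : Algebra.FormallyUnramified W.functionField Z.functionField :=
    .of_restrictScalars Γ(W, U) _ _
  have : Algebra.EssFiniteType Γ(Z, U') Z.functionField :=
    .of_isLocalization _ (nonZeroDivisors Γ(Z, U'))
  have : Algebra.EssFiniteType Γ(W, U) Z.functionField := .comp _ Γ(Z, U') _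
  have : Algebra.EssFiniteType W.functionField Z.functionField := .of_comp Γ(W, U) _ _
  exact Algebra.FormallyUnramified.finite_of_free W.functionField Z.functionField

/-- Let `g : Z → W` be proper and dominant. By the valuative criterion, a valuation ring `V` of
`ℂ(Z)` which contains the functions on some affine open subset of `W` contains the functions on
some affine open subset of `Z`. -/
lemma exists_affine_sections_to_valuationRing [IsProper g] {U : W.Opens} (hU : IsAffineOpen U)
    (hη : genericPoint W ∈ U) (V : Type) [CommRing V] [IsDomain V] [ValuationRing V]
    [Algebra V Z.functionField] [IsFractionRing V Z.functionField] (φ : Γ(W, U) →+* V)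
    (hφ : ∀ a, algebraMap V Z.functionField (φ a) =
      functionFieldMap g (germ W U (genericPoint W) hη a)) :
    ∃ (U' : Z.Opens) (_ : IsAffineOpen U') (hη' : genericPoint Z ∈ U') (ψ : Γ(Z, U') →+* V),
      ∀ a, algebraMap V Z.functionField (ψ a) = germ Z U' (genericPoint Z) hη' a := by
  let α : CommRingCat.of V ⟶ Z.functionField := CommRingCat.ofHom (algebraMap V Z.functionField)
  have hsq : CommSq (Z.fromSpecStalk (genericPoint Z)) (Spec.map α) g
      (Spec.map (CommRingCat.ofHom φ) ≫ hU.fromSpec) := by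
    constructor
    have h1 : CommRingCat.ofHom φ ≫ α = W.presheaf.germ U (genericPoint W) hη ≫
        W.presheaf.stalkSpecializes (specializes_of_eq (map_genericPoint g)) ≫
          g.stalkMap (genericPoint Z) := by
      ext a
      exact hφ a
    rw [← Spec.map_comp_assoc, h1, Spec.map_comp_assoc, Spec.map_comp_assoc]
    change _ = _ ≫ _ ≫ hU.fromSpecStalk hη
    rw [hU.fromSpecStalk_eq_fromSpecStalk, Scheme.SpecMap_stalkSpecializes_fromSpecStalk,
      Scheme.SpecMap_stalkMap_fromSpecStalk]
  have hval : ValuativeCriterion.Existence g := by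
    have : IsProper g := inferInstance
    rw [IsProper.eq_valuativeCriterion] at this
    exact this.1.1.1.existence
  let S : ValuativeCommSq g := { R := V, K := Z.functionField, i₁ := _, i₂ := _, commSq := hsq }
  obtain ⟨⟨l⟩⟩ := hval S
  obtain ⟨U', hU', hz, -⟩ := exists_isAffineOpen_mem_and_subset
    (x := l.l (IsLocalRing.closedPoint V)) (U := ⊤) trivial
  have hη' := genericPoint_mem Z U' ⟨_, hz⟩
  let l' : Spec (CommRingCat.of V) ⟶ Z := l.l
  refine ⟨U', hU', hη', (Z.presheaf.germ U' _ hz ≫ Scheme.stalkClosedPointTo l').hom,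
    fun a => ?_⟩
  have key : (Z.presheaf.germ U' _ hz ≫ Scheme.stalkClosedPointTo l') ≫ α =
      Z.presheaf.germ U' (genericPoint Z) hη' := by
    apply Spec.map_injective
    rw [← cancel_mono hU'.fromSpec, Spec.map_comp_assoc, Spec.map_comp_assoc]
    change _ ≫ _ ≫ hU'.fromSpecStalk hz = hU'.fromSpecStalk hη'
    rw [hU'.fromSpecStalk_eq_fromSpecStalk, hU'.fromSpecStalk_eq_fromSpecStalk,
      Scheme.Spec_stalkClosedPointTo_fromSpecStalk]
    exact l.fac_left
  exact congrArg (fun f : Γ(Z, U') ⟶ Z.functionField => f.hom a) key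

end

/-- The pull-back of a regular form is regular. -/
lemma IsRegular.pullbackForm [Smooth (Z ↘ SpecC)] {n : ℕ} {ω : MeromorphicForm W n}
    (hω : IsRegular ω) (hg : IsDominant g) : IsRegular (pullbackForm g hg ω) := by
  have : IsDominant g := hg
  rw [isRegular_iff_forall_exists]
  intro z
  obtain ⟨η, hη⟩ := hω
  obtain ⟨U, hU, hzU, -⟩ := exists_isAffineOpen_mem_and_subset (x := g z) (U := ⊤) trivial
  obtain ⟨U', hU', hzU', hle⟩ := exists_isAffineOpen_mem_and_subset (x := z) (U := g ⁻¹ᵁ U) hzU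
  have hηU' := genericPoint_mem Z U' ⟨z, hzU'⟩
  refine ⟨U', hU', hzU', hηU', formMap (pullbackSections g U U' hle) n (η.val ⟨U, hU⟩), ?_⟩
  rw [MeroForms.pullbackForm, ← hη ⟨U, hU⟩ ⟨_, hzU⟩, ← formMap_comp, ← formMap_comp]
  exact formMap_congr (germ_pullbackSections g U U' hle _ hηU') _

/-- A meromorphic form whose pull-back along a proper generically étale morphism is regular is
itself regular. -/
lemma isRegular_of_isRegular_pullbackForm [Smooth (Z ↘ SpecC)] [Smooth (W ↘ SpecC)] [IsProper g]
    (hg : GenericallyEtale g) {n : ℕ} {ω : MeromorphicForm W n}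
    (hω : IsRegular (pullbackForm g hg.isDominant ω)) : IsRegular ω := by
  have : IsDominant g := hg.isDominant
  rw [isRegular_iff_forall_exists]
  intro w
  obtain ⟨U, hU, hwU, -⟩ := exists_isAffineOpen_mem_and_subset (x := w) (U := ⊤) trivial
  have hη := genericPoint_mem W U ⟨w, hwU⟩
  refine ⟨U, hU, hwU, hη, ?_⟩
  have hne : Nonempty U := ⟨⟨_, hη⟩⟩
  have := functionField_isFractionRing_of_isAffineOpen W U hU
  have := smooth_sections hU
  let _ : Algebra W.functionField Z.functionField :=
    (functionFieldMap g : W.functionField →+* Z.functionField).toAlgebra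
  let _ : Algebra Γ(W, U) Z.functionField :=
    ((functionFieldMap g : W.functionField →+* Z.functionField).comp
      (algebraMap Γ(W, U) W.functionField)).toAlgebra
  have : IsScalarTower Γ(W, U) W.functionField Z.functionField :=
    IsScalarTower.of_algebraMap_eq fun _ => rfl
  have : IsScalarTower ℂ W.functionField Z.functionField :=
    IsScalarTower.of_algebraMap_eq fun a => ((functionFieldMap g).commutes a).symm
  have : IsScalarTower ℂ Γ(W, U) Z.functionField :=
    IsScalarTower.of_algebraMap_eq fun a => by
      rw [IsScalarTower.algebraMap_apply ℂ W.functionField Z.functionField,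
        IsScalarTower.algebraMap_apply ℂ Γ(W, U) W.functionField]
      rfl
  have : FiniteDimensional W.functionField Z.functionField := hg.finite_functionFieldMap g
  suffices ω ∈ Set.range (formMap (IsScalarTower.toAlgHom ℂ Γ(W, U) W.functionField) n) by
    obtain ⟨y, rfl⟩ := this
    exact ⟨y, formMap_germ U hη y⟩
  refine mem_range_formMap_of_valuation (L := Z.functionField) ω ?_
  intro V _ _ _ _ _ _ _ _ _
  obtain ⟨U', hU', hη', ψ, hψ⟩ := exists_affine_sections_to_valuationRing g hU hη V
    (algebraMap Γ(W, U) V) (fun a => (IsScalarTower.algebraMap_apply _ V Z.functionField a).symm)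
  have hne' : Nonempty U' := ⟨⟨_, hη'⟩⟩
  -- `ψ` is `ℂ`-linear because `V` embeds into `ℂ(Z)`.
  let ψ' : Γ(Z, U') →ₐ[ℂ] V :=
    { ψ with
      commutes' := fun r => by
        apply IsFractionRing.injective V Z.functionField
        refine (hψ _).trans ?_
        rw [AlgHom.commutes, ← IsScalarTower.algebraMap_apply] }
  obtain ⟨η, hηω⟩ := hω
  refine ⟨formMap ψ' n (η.val ⟨U', hU'⟩), ?_⟩
  rw [← formMap_comp]
  refine Eq.trans ?_ (hηω ⟨U', hU'⟩ ⟨_, hη'⟩)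
  exact formMap_congr hψ _

end Pullback

end MeroForms

end

theorem mainTheorem7 {Z W : Scheme.{0}} [Z.Over MeroForms.SpecC] [W.Over MeroForms.SpecC]
    [MeroForms.IsComplexVariety Z] [MeroForms.IsComplexVariety W]
    [Smooth (Z ↘ MeroForms.SpecC)] [Smooth (W ↘ MeroForms.SpecC)]
    (g : Z ⟶ W) [g.IsOver MeroForms.SpecC] [IsProper g]
    (hg : MeroForms.GenericallyEtale g) (k : ℕ) (ω : MeroForms.MeromorphicForm W k) :
    MeroForms.IsRegular ω ↔
      MeroForms.IsRegular (MeroForms.pullbackForm g hg.isDominant ω) :=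
  ⟨fun h => h.pullbackForm g hg.isDominant,
    MeroForms.isRegular_of_isRegular_pullbackForm g hg⟩
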